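/- Let $X$ be a finite set with $n$ elements and let $(X,d)$ be a full tree, i.e. there are a finite tree $T$, a bijection $\phi:X\to V(T)$ and positive edge weights $w$ on $T$ such that for all $x,y\in X$, $d(x,y)$ is the total weight of the path in $T$ from $\phi(x)$ to $\phi(y)$. Then there is a unique system $\mathcal S$ of pairwise compatible splits of $X$ such that $d=\sum_{\sigma\in\mathcal S}\alpha_\sigma\delta_\sigma$ for some weights $\alpha_\sigma>0$. Here a split $\sigma=A|B$ is an unordered pair of disjoint nonempty sets with $A\cup B=X$; $\delta_\sigma(x,y)$ is $0$ if $x,y$ lie on the same side of $\sigma$ and $1$ otherwise; and $A|B$, $C|D$ are compatible if one of $A\cap C$, $A\cap D$, $B\cap C$, $B\cap D$ is empty. For this $\mathcal S$ the following hold. (1) For $\mathcal S'\subseteq\mathcal S$ let $\pi(\mathcal S')$ be the partition of $X$ in which $x,y$ are in the same block if and only if $\delta_\sigma(x,y)=0$ for all $\sigma\in\mathcal S'$ (equivalently, $\sum_{\sigma\in\mathcal S'}\alpha_\sigma\delta_\sigma(x,y)=0$). The map $\pi$ from the subsets of $\mathcal S$ to the partitions of $X$ is injective. (2) Let $V(\mathcal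 S)$ be the space of all $x\in\mathbb R^X$ with $\sum_i x_i=0$ and $x_i=x_j$ whenever $i,j$ are in the same block of $\pi(\mathcal S)$, and let $\mathcal A(\mathcal S)$ be the arrangement in $V(\mathcal S)$ of the hyperplanes $H_\sigma$, $\sigma=A|B\in\mathcal S$, where $H_\sigma$ is the orthogonal complement of $\frac{|B|}{n}\mathbb 1_A-\frac{|A|}{n}\mathbb 1_B$. The poset of all intersections of subsets of $\mathcal A(\mathcal S)$ (including the empty intersection $V(\mathcal S)$), ordered by reverse inclusion, is Boolean: it is isomorphic to the lattice of all subsets of a set with $n-1$ elements. (3) Let $P_d(X)=\operatorname{conv}\{(\mathbb 1_i-\mathbb 1_j)/d(i,j) : i,j\in X,\ i\ne j\}\subseteq\mathbb R^X$ be the fundamental polytope, and let $f_k^{P_d(X)}$ be its number of $k$-dimensional faces, where the empty face counts as a face of dimension $-1$. Then $$f_{i-1}^{P_d(X)}=2^i\binom{n-1}{i}\qquad\text{for } 0\le i\le n-1.$$ -/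

import Mathlib

noncomputable section

universe u v

/-! ### Fundamental polytopes and face numbers -/

/-- The indicator vector `𝟙_A ∈ ℝ^X` of `A ⊆ X`; the standard basis vectors are
`indVec {k}`. -/
def indVec {X : Type u} (A : Set X) : X → ℝ := A.indicator 1

/-- The vector `e_{i,j} = (𝟙_i - 𝟙_j) / d(i,j)`. -/
def elemVec {X : Type u} (d : X → X → ℝ) (i j : X) : X → ℝ :=
  (d i j)⁻¹ • (indVec {i} - indVec {j})

/-- The fundamental polytope `P_d(X) = conv {e_{i,j} : i ≠ j}`. -/
def fundamentalPolytope {X : Type u} (d : X → X → ℝ) : Set (X → ℝ) :=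
  convexHull ℝ {x | ∃ i j : X, i ≠ j ∧ x = elemVec d i j}

/-- The dimension of a face (the dimension of its affine hull), the empty face having
dimension `-1`. -/
def faceDim {E : Type u} [AddCommGroup E] [Module ℝ E] (F : Set E) : ℤ :=
  open Classical in if F = ∅ then -1 else (Module.finrank ℝ (vectorSpan ℝ F) : ℤ)

/-- The number `f_i^P` of `i`-dimensional faces of a polytope `P`. The faces of `P` are its
exposed subsets; with Mathlib's convention the empty set is one of them, and so is `P`. -/
def faceNumber {E : Type u} [AddCommGroup E] [Module ℝ E] [TopologicalSpace E]
    (P : Set E) (i : ℤ) : ℕ :=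
  Set.ncard {F : Set E | IsExposed ℝ P F ∧ faceDim F = i}

/-! ### Full trees -/

/-- The distance of two vertices in a finite connected graph with edge weights `w`: the minimum
of the total weights of the paths joining them. Only the values of `w` on edges matter. -/
def weightedDist {V : Type v} (G : SimpleGraph V) (w : Sym2 V → ℝ) (a b : V) : ℝ :=
  ⨅ p : G.Path a b, ((p : G.Walk a b).edges.map w).sum

/-- An `X`-tree with vertex set `V`: a tree with a map `X → V` whose image contains every vertex
incident to at most two edges. -/
structure XTree (X : Type u) (V : Type v) where
  graph : SimpleGraph V
  isTree : graph.IsTree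
  label : X → V
  low_degree : ∀ a : V, (graph.neighborSet a).ncard ≤ 2 → a ∈ Set.range label

/-- `d` is induced by a positively weighted finite `X`-tree whose labelling map is bijective. -/
def IsFullTree {X : Type u} (d : X → X → ℝ) : Prop :=
  ∃ (V : Type u) (_ : Finite V) (T : XTree X V) (w : Sym2 V → ℝ),
    (∀ e ∈ T.graph.edgeSet, 0 < w e) ∧
    (∀ x y : X, d x y = weightedDist T.graph w (T.label x) (T.label y)) ∧
    Function.Bijective T.label

/-! ### Split systems -/

/-- A split `A|B` of `X`: an unordered pair of nonempty disjoint sets with union `X`. -/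
@[ext]
structure Split (X : Type u) where
  sides : Set (Set X)
  exists_sides : ∃ A B : Set X, A.Nonempty ∧ B.Nonempty ∧ Disjoint A B ∧ A ∪ B = Set.univ ∧
    sides = {A, B}

namespace Split

variable {X : Type u}

/-- `i ∼_σ j`: the points `i` and `j` lie on the same side of `σ`. -/
def Rel (σ : Split X) (i j : X) : Prop := ∃ A ∈ σ.sides, i ∈ A ∧ j ∈ A

theorem rel_equivalence (σ : Split X) : Equivalence σ.Rel := by
  obtain ⟨A, B, -, -, hd, hu, hs⟩ := σ.exists_sides
  have key : ∀ i j, σ.Rel i j ↔ (i ∈ A ∧ j ∈ A) ∨ (i ∈ B ∧ j ∈ B) := by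
    intro i j
    simp [Rel, hs]
  have hcov : ∀ i, i ∈ A ∨ i ∈ B := fun i => by
    have : i ∈ A ∪ B := hu ▸ Set.mem_univ i
    exact this
  have hdis : ∀ i, i ∈ A → i ∈ B → False := fun i h1 h2 => Set.disjoint_left.mp hd h1 h2
  refine ⟨fun i => ?_, fun {i j} h => ?_, fun {i j k} h h' => ?_⟩
  · rw [key]; rcases hcov i with h | h <;> simp [h]
  · rw [key] at *; tauto
  · rw [key] at *
    have := hdis j
    tauto

/-- The split pseudometric `δ_σ`. -/
def delta (σ : Split X) (i j : X) : ℝ := open Classical in if σ.Rel i j then 0 else 1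

/-- Two splits `A|B` and `C|D` are compatible if one of `A ∩ C`, `A ∩ D`, `B ∩ C`, `B ∩ D` is
empty. -/
def Compatible (σ τ : Split X) : Prop := ∃ A ∈ σ.sides, ∃ C ∈ τ.sides, A ∩ C = ∅

/-- For a side `A` of a split, the vector `(|Aᶜ| / n) 𝟙_A - (|A| / n) 𝟙_{Aᶜ}`, `n = |X|`. -/
def sideVec (A : Set X) : X → ℝ :=
  ((Aᶜ.ncard : ℝ) / Nat.card X) • indVec A - ((A.ncard : ℝ) / Nat.card X) • indVec Aᶜ

/-- The segment `S_σ`, whose endpoints are the vectors of the two sides of `σ`. -/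
def seg (σ : Split X) : Set (X → ℝ) := convexHull ℝ (sideVec '' σ.sides)

end Split

/-- The function `d_α = ∑_{σ ∈ S} α_σ δ_σ` of a weighted system `S` of splits. -/
def splitDist {X : Type u} (S : Finset (Split X)) (α : Split X → ℝ) (i j : X) : ℝ :=
  ∑ σ ∈ S, α σ * σ.delta i j

theorem splitDist_eq_zero_iff {X : Type u} {S : Finset (Split X)} {α : Split X → ℝ}
    (hα : ∀ σ ∈ S, 0 < α σ) (i j : X) :
    splitDist S α i j = 0 ↔ ∀ σ ∈ S, σ.Rel i j := by
  unfold splitDist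
  rw [Finset.sum_eq_zero_iff_of_nonneg]
  · refine forall₂_congr fun σ hσ => ?_
    have := (hα σ hσ).ne'
    by_cases h : σ.Rel i j <;> simp [Split.delta, h, this]
  · intro σ hσ
    have := (hα σ hσ).le
    by_cases h : σ.Rel i j <;> simp [Split.delta, h, this]

/-- The partition `π(S)` of `X`: `i` and `j` are in the same block iff `d_α(i,j) = 0`, for `α`
the constant weight `1`; any other positive weight gives the same partition, see
`splitPartition_iff`. Partitions of `X` are represented by equivalence relations. -/
def splitPartition {X : Type u} (S : Finset (Split X)) : Setoid X where
  r i j := splitDist S (fun _ => 1) i j = 0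
  iseqv := by
    have h : ∀ i j, splitDist S (fun _ => 1) i j = 0 ↔ ∀ σ ∈ S, σ.Rel i j :=
      splitDist_eq_zero_iff fun _ _ => one_pos
    refine ⟨fun i => ?_, fun {i j} hij => ?_, fun {i j k} hij hjk => ?_⟩
    · exact (h _ _).2 fun σ _ => σ.rel_equivalence.refl i
    · exact (h _ _).2 fun σ hσ => σ.rel_equivalence.symm ((h _ _).1 hij σ hσ)
    · exact (h _ _).2 fun σ hσ =>
        σ.rel_equivalence.trans ((h _ _).1 hij σ hσ) ((h _ _).1 hjk σ hσ)

theorem splitPartition_iff {X : Type u} {S : Finset (Split X)} {α : Split X → ℝ}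
    (hα : ∀ σ ∈ S, 0 < α σ) (i j : X) :
    splitPartition S i j ↔ splitDist S α i j = 0 :=
  (splitDist_eq_zero_iff (fun _ _ => one_pos) i j).trans (splitDist_eq_zero_iff hα i j).symm

/-- `S` is a system of pairwise compatible splits with `d = d_α` for some positive weighting `α`
of `S`. -/
def IsCompatibleDecomposition {X : Type u} (d : X → X → ℝ) (S : Finset (Split X)) : Prop :=
  (∀ σ ∈ S, ∀ τ ∈ S, σ.Compatible τ) ∧
    ∃ α : Split X → ℝ, (∀ σ ∈ S, 0 < α σ) ∧ ∀ i j : X, d i j = splitDist S α i j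

/-! ### Arrangements of hyperplanes -/

/-- The set of all intersections of subsets of an arrangement of subspaces of `V`; the empty
intersection is `V`. -/
def intersections {V : Type u} [AddCommGroup V] [Module ℝ V] (𝒜 : Set (Submodule ℝ V)) :
    Set (Submodule ℝ V) :=
  {x | ∃ ℬ ⊆ 𝒜, x = sInf ℬ}

/-- The poset of intersections of an arrangement, ordered by reverse inclusion. -/
abbrev IntersectionPoset {V : Type u} [AddCommGroup V] [Module ℝ V]
    (𝒜 : Set (Submodule ℝ V)) : Type u :=
  (intersections 𝒜)ᵒᵈ

/-- The ambient space `V(S)` of vectors with coordinate sum `0` that are constant on the blocks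
of `π(S)`. -/
def ambientSpace {X : Type u} [Fintype X] (S : Finset (Split X)) : Submodule ℝ (X → ℝ) where
  carrier := {x | ∑ i, x i = 0 ∧ ∀ i j, splitPartition S i j → x i = x j}
  add_mem' := by
    rintro a b ⟨ha, ha'⟩ ⟨hb, hb'⟩
    refine ⟨by simp [Finset.sum_add_distrib, ha, hb], fun i j h => ?_⟩
    simp [ha' i j h, hb' i j h]
  zero_mem' := by simp
  smul_mem' := by
    rintro c a ⟨ha, ha'⟩
    refine ⟨by simp [← Finset.mul_sum, ha], fun i j h => ?_⟩
    simp [ha' i j h]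

/-- The hyperplane `H_σ = (S_σ)^⊥` in `V(S)`. -/
def splitHyperplane {X : Type u} [Fintype X] (S : Finset (Split X)) (σ : Split X) :
    Submodule ℝ (ambientSpace S) where
  carrier := {x | ∀ y ∈ σ.seg, (x : X → ℝ) ⬝ᵥ y = 0}
  add_mem' := by
    intro a b ha hb y hy
    simp [ha y hy, hb y hy]
  zero_mem' := by simp
  smul_mem' := by
    intro c a ha y hy
    simp [ha y hy]

/-- The arrangement `𝒜(S) = {H_σ : σ ∈ S}` in `V(S)`. -/
def splitArrangement {X : Type u} [Fintype X] (S : Finset (Split X)) :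
    Set (Submodule ℝ (ambientSpace S)) :=
  splitHyperplane S '' S

end

universe u v

/-! ### Faces of cross-polytopes -/

section CrossPolytope

variable {E : Type u} [AddCommGroup E] [Module ℝ E]

/-! Each of the `n - 1` edges `e` of the tree cuts `X` into two sides. Crossing an edge `f` changes
the side with respect to `e` only when `e = f`, so the indicators `𝟙_{side e}` are dual to the edge
vectors `𝟙_{src f} - 𝟙_{tgt f}` (`indVec_src_sub_tgt`). `EdgeCutSystem` records this, and everything
follows from it and connectedness.

Summing weights along paths writes `d` as a positive combination of the edge splits. It is the only
such decomposition (`eq_splits`): equality in the triangle inequality for `d` passes to each split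
occurring in it, and a split separating the ends of `e` is then the split of `e`. The ends of `e`
show whether its split belongs to a subsystem, so `π` is injective. Each edge vector lies on every
hyperplane but its own, so the intersection poset is Boolean.

Finally `e_{i,j}` combines the vectors of the edges with coefficients whose absolute values sum to
`1`. Hence `P_d(X)` is a cross-polytope on `n - 1` independent vectors (`fundamentalPolytope_eq`),
and a proper face is a choice of edges with a sign for each (`faceNumber_crossPolytope`). -/

theorem convexHull_maximizers {V : Set E} (l : E →ₗ[ℝ] ℝ) {M : ℝ} (hM : ∀ v ∈ V, l v ≤ M) :
    ∀ x ∈ convexHull ℝ V, l x ≤ M ∧ (l x = M → x ∈ convexHull ℝ {v ∈ V | l v = M}) := by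
  refine convexHull_min (t := {x | l x ≤ M ∧ (l x = M → x ∈ convexHull ℝ {v ∈ V | l v = M})})
    (fun v hv => ⟨hM v hv, fun h => subset_convexHull ℝ _ ⟨hv, h⟩⟩) ?_
  rintro x ⟨hx, hx'⟩ y ⟨hy, hy'⟩ a b ha hb hab
  -- A point of weight zero is not constrained by equality, so the degenerate cases are split off;
  -- positive weights can be cancelled.
  rcases ha.eq_or_lt with rfl | ha
  · obtain rfl : b = 1 := by linarith
    simpa using ⟨hy, hy'⟩
  rcases hb.eq_or_lt with rfl | hb
  · obtain rfl : a = 1 := by linarith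
    simpa using ⟨hx, hx'⟩
  have hl : l (a • x + b • y) = a * l x + b * l y := by simp
  have h1 : a * l x ≤ a * M := by gcongr
  have h2 : b * l y ≤ b * M := by gcongr
  have h3 : a * M + b * M = M := by rw [← add_mul, hab, one_mul]
  refine ⟨by linarith, fun h => ?_⟩
  have h4 : l x = M := mul_left_cancel₀ ha.ne' (by linarith)
  have h5 : l y = M := mul_left_cancel₀ hb.ne' (by linarith)
  exact convex_convexHull ℝ _ (hx' h4) (hy' h5) ha.le hb.le hab

theorem setOf_mem_convexHull_eq {V : Set E} (l : E →ₗ[ℝ] ℝ) {M : ℝ} (hM : ∀ v ∈ V, l v ≤ M) :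
    {x ∈ convexHull ℝ V | l x = M} = convexHull ℝ {v ∈ V | l v = M} := by
  refine Set.Subset.antisymm (fun x hx => (convexHull_maximizers l hM x hx.1).2 hx.2) fun x hx => ?_
  refine ⟨convexHull_mono (fun v hv => hv.1) hx, ?_⟩
  exact convexHull_min (t := l ⁻¹' {M}) (fun v hv => hv.2)
    ((convex_singleton M).linear_preimage l) hx

variable {ι : Type v}

/-- The cross-polytope with vertices `±b i`. -/
def crossPolytope (b : ι → E) : Set E := convexHull ℝ (Set.range b ∪ Set.range (-b))

/-- The vector `b i` if `i ∈ U` and `-b i` otherwise. -/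
noncomputable def signedVec [DecidableEq ι] (b : ι → E) (U : Finset ι) (i : ι) : E :=
  if i ∈ U then b i else -b i

/-- The simplex with vertices `b i` for `i ∈ T ∩ U` and `-b i` for `i ∈ T \ U`. -/
def crossFace [DecidableEq ι] (b : ι → E) (T U : Finset ι) : Set E :=
  convexHull ℝ (signedVec b U '' T)

theorem sum_smul_mem_crossPolytope [Fintype ι] (b : ι → E) (c : ι → ℝ) (hc : ∑ i, |c i| = 1) :
    ∑ i, c i • b i ∈ crossPolytope b := by
  have h : ∀ i, c i • b i = |c i| • (if 0 ≤ c i then b i else -b i) := by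
    intro i
    split_ifs with h
    · rw [abs_of_nonneg h]
    · rw [abs_of_neg (not_le.1 h), neg_smul_neg]
  simp_rw [h]
  refine (convex_convexHull ℝ _).sum_mem (fun i _ => abs_nonneg _) hc fun i _ => ?_
  refine subset_convexHull ℝ _ ?_
  split_ifs
  · exact Or.inl ⟨i, rfl⟩
  · exact Or.inr ⟨i, rfl⟩

/-! ### Signed simplices in the presence of a dual family -/

section Dual

variable [DecidableEq ι] {b : ι → E} {φ : ι → E →ₗ[ℝ] ℝ}

theorem linearIndependent_of_dual (hφ : ∀ i j, φ i (b j) = if i = j then 1 else 0) :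
    LinearIndependent ℝ b := by
  rw [linearIndependent_iff']
  intro s g hg i hi
  have := congrArg (φ i) hg
  simpa [hφ, hi] using this

theorem dual_signedVec (hφ : ∀ i j, φ i (b j) = if i = j then 1 else 0) (U : Finset ι) (i j : ι) :
    φ i (signedVec b U j) = if i = j then (if i ∈ U then 1 else -1) else 0 := by
  unfold signedVec
  by_cases h : i = j
  · subst h
    rw [if_pos rfl]
    split_ifs <;> simp [hφ]
  · split_ifs <;> simp [hφ, h]

theorem vec_mem_crossFace_iff (hφ : ∀ i j, φ i (b j) = if i = j then 1 else 0)
    {T U : Finset ι} (hU : U ⊆ T) (i : ι) : b i ∈ crossFace b T U ↔ i ∈ U := by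
  refine ⟨fun h => ?_, fun h => subset_convexHull ℝ _ ⟨i, hU h, by simp [signedVec, h]⟩⟩
  by_contra hi
  have : φ i (b i) ≤ 0 := by
    refine convexHull_min (t := {x | φ i x ≤ 0}) ?_ (convex_halfSpace_le (φ i).isLinear 0) h
    rintro _ ⟨j, -, rfl⟩
    simp only [Set.mem_ofPred_eq, dual_signedVec hφ]
    split_ifs <;> norm_num
  simp [hφ] at this
  linarith

theorem neg_vec_mem_crossFace_iff (hφ : ∀ i j, φ i (b j) = if i = j then 1 else 0)
    {T U : Finset ι} (i : ι) : -b i ∈ crossFace b T U ↔ i ∈ T \ U := by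
  rw [Finset.mem_sdiff]
  refine ⟨fun h => ?_, fun h => subset_convexHull ℝ _ ⟨i, h.1, by simp [signedVec, h.2]⟩⟩
  by_contra hi
  have : 0 ≤ φ i (-b i) := by
    refine convexHull_min (t := {x | 0 ≤ φ i x}) ?_ (convex_halfSpace_ge (φ i).isLinear 0) h
    rintro _ ⟨j, hj, rfl⟩
    simp only [Set.mem_ofPred_eq, dual_signedVec hφ]
    split_ifs with h1 h2
    · norm_num
    · subst h1; exact absurd ⟨hj, h2⟩ hi
    · norm_num
  simp [hφ] at this
  linarith

/-- The set remembers its signed vertices: `U` and `T \ U` are read off from which `b i` and `-b i`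
it contains. -/
theorem crossFace_injOn (hφ : ∀ i j, φ i (b j) = if i = j then 1 else 0)
    {T U T' U' : Finset ι} (hU : U ⊆ T) (hU' : U' ⊆ T') (h : crossFace b T U = crossFace b T' U') :
    T = T' ∧ U = U' := by
  have h1 : U = U' := by
    ext i; rw [← vec_mem_crossFace_iff hφ hU, h, vec_mem_crossFace_iff hφ hU']
  have h2 : T \ U = T' \ U' := by
    ext i; rw [← neg_vec_mem_crossFace_iff hφ, h, neg_vec_mem_crossFace_iff hφ]
  refine ⟨?_, h1⟩
  rw [← Finset.sdiff_union_of_subset hU, ← Finset.sdiff_union_of_subset hU', h2, h1]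

theorem faceDim_crossFace (hφ : ∀ i j, φ i (b j) = if i = j then 1 else 0) (T U : Finset ι) :
    faceDim (crossFace b T U) = (T.card : ℤ) - 1 := by
  unfold faceDim
  -- Empty `T` gives the empty face, whose conventional dimension `-1` fits the formula.
  rcases T.eq_empty_or_nonempty with rfl | hT
  · simp [crossFace]
  have hne : crossFace b T U ≠ ∅ := by
    rw [← Set.nonempty_iff_ne_empty]
    exact (Set.Nonempty.image _ hT).convexHull
  rw [if_neg hne]
  have hli : LinearIndependent ℝ (signedVec b U) :=
    linearIndependent_of_dual (φ := fun i => (if i ∈ U then (1 : ℝ) else -1) • φ i) fun i j => by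
      rw [LinearMap.smul_apply, dual_signedVec hφ]
      split_ifs <;> simp
  have hai : AffineIndependent ℝ (fun i : T => signedVec b U i) :=
    (hli.comp _ Subtype.val_injective).affineIndependent
  have hr : signedVec b U '' T = Set.range (fun i : T => signedVec b U i) := by
    ext; simp
  obtain ⟨m, hm⟩ : ∃ m, T.card = m + 1 := ⟨T.card - 1, by have := hT.card_pos; omega⟩
  have := hai.finrank_vectorSpan (n := m) (by simpa using hm)
  rw [crossFace, ← direction_affineSpan, affineSpan_convexHull, direction_affineSpan, hr, this, hm]
  simp

/-- This keeps the improper face out of the count: half the difference of `b i` and `-b i` is `b i`,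
so the direction space contains the span of `b`. -/
theorem card_le_faceDim_crossPolytope [Fintype ι] [FiniteDimensional ℝ E] [Nonempty ι]
    (hφ : ∀ i j, φ i (b j) = if i = j then 1 else 0) :
    (Fintype.card ι : ℤ) ≤ faceDim (crossPolytope b) := by
  have hmem : ∀ i, b i ∈ crossPolytope b := fun i => subset_convexHull ℝ _ (Or.inl ⟨i, rfl⟩)
  have hmem' : ∀ i, -b i ∈ crossPolytope b := fun i => subset_convexHull ℝ _ (Or.inr ⟨i, rfl⟩)
  have hne : crossPolytope b ≠ ∅ :=
    Set.nonempty_iff_ne_empty.1 ⟨_, hmem (Classical.arbitrary ι)⟩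
  rw [faceDim, if_neg hne, ← finrank_span_eq_card (linearIndependent_of_dual hφ)]
  norm_cast
  refine Submodule.finrank_mono (Submodule.span_le.2 ?_)
  rintro _ ⟨i, rfl⟩
  have h := vsub_mem_vectorSpan ℝ (hmem i) (hmem' i)
  have h2 := Submodule.smul_mem _ (2⁻¹ : ℝ) h
  rwa [vsub_eq_sub, sub_neg_eq_add, ← two_smul ℝ (b i), smul_smul, inv_mul_cancel₀ two_ne_zero,
    one_smul] at h2

end Dual

/-! ### Exposed faces of the cross-polytope and their number -/

section Exposed

variable [DecidableEq ι] [TopologicalSpace E] {b : ι → E} {φ : ι → E →L[ℝ] ℝ}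

theorem isExposed_crossFace (hφ : ∀ i j, φ i (b j) = if i = j then 1 else 0) (T U : Finset ι)
    [ContinuousAdd E] [ContinuousSMul ℝ E] :
    IsExposed ℝ (crossPolytope b) (crossFace b T U) := by
  rintro hne
  -- The signed sum of dual functionals is `1` at the vertices of the simplex and `0` or `-1` at all
  -- other generators.
  let l : E →L[ℝ] ℝ := ∑ i ∈ T, (if i ∈ U then (1 : ℝ) else -1) • φ i
  have hl : ∀ j, l (b j) = if j ∈ T then (if j ∈ U then (1 : ℝ) else -1) else 0 := by
    intro j
    simp only [l, sum_apply, smul_apply, hφ, smul_eq_mul,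
      mul_ite, mul_one, mul_zero, Finset.sum_ite_eq']
  have hV : ∀ v ∈ Set.range b ∪ Set.range (-b), (l : E →ₗ[ℝ] ℝ) v ≤ 1 := by
    rintro _ (⟨j, rfl⟩ | ⟨j, rfl⟩)
    · simp only [ContinuousLinearMap.coe_coe, hl]; split_ifs <;> norm_num
    · simp only [ContinuousLinearMap.coe_coe, Pi.neg_apply, map_neg, hl]; split_ifs <;> norm_num
  have hset : {v ∈ Set.range b ∪ Set.range (-b) | (l : E →ₗ[ℝ] ℝ) v = 1} = signedVec b U '' T := by
    ext x
    constructor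
    · rintro ⟨⟨j, rfl⟩ | ⟨j, rfl⟩, hx⟩
      · simp only [ContinuousLinearMap.coe_coe, hl] at hx
        split_ifs at hx with h1 h2
        · exact ⟨j, h1, by simp [signedVec, h2]⟩
        all_goals norm_num at hx
      · simp only [ContinuousLinearMap.coe_coe, Pi.neg_apply, map_neg, hl] at hx
        split_ifs at hx with h1 h2
        · norm_num at hx
        · exact ⟨j, h1, by simp [signedVec, h2]⟩
        · norm_num at hx
    · rintro ⟨j, hj, rfl⟩
      have hj' : j ∈ T := hj
      unfold signedVec
      split_ifs with h
      · exact ⟨Or.inl ⟨j, rfl⟩, by simp [hl, hj', h]⟩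
      · exact ⟨Or.inr ⟨j, rfl⟩, by simp [hl, hj', h]⟩
  refine ⟨l, ?_⟩
  have hF : crossFace b T U = {x ∈ crossPolytope b | (l : E →ₗ[ℝ] ℝ) x = 1} := by
    rw [crossPolytope, setOf_mem_convexHull_eq _ hV, hset, crossFace]
  obtain ⟨x₀, hx₀⟩ := hne
  rw [hF] at hx₀ ⊢
  ext x
  constructor
  · rintro ⟨hx, hx1⟩
    refine ⟨hx, fun y hy => ?_⟩
    exact ((convexHull_maximizers _ hV y hy).1).trans hx1.ge
  · rintro ⟨hx, hmax⟩
    exact ⟨hx, le_antisymm (convexHull_maximizers _ hV x hx).1 (hx₀.2.ge.trans (hmax x₀ hx₀.1))⟩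

/-- Let `M` be the maximum of the exposing functional. If `M = 0`, symmetry makes it vanish on all
generators, which exposes the whole polytope. Otherwise at most one of `b i`, `-b i` attains `M`,
and these vertices define `T` and `U`. -/
theorem IsExposed.eq_or_exists_crossFace [Fintype ι] {F : Set E} (hF : IsExposed ℝ (crossPolytope b) F) :
    F = crossPolytope b ∨ ∃ T U : Finset ι, U ⊆ T ∧ F = crossFace b T U := by
  rcases F.eq_empty_or_nonempty with rfl | hne
  · exact Or.inr ⟨∅, ∅, subset_rfl, by simp [crossFace]⟩
  obtain ⟨l, hl⟩ := hF hne
  obtain ⟨x₀, hx₀⟩ := hne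
  rw [hl] at hx₀
  obtain ⟨hx₀P, hmax⟩ := hx₀
  set M := l x₀ with hM
  have hV : ∀ v ∈ Set.range b ∪ Set.range (-b), (l : E →ₗ[ℝ] ℝ) v ≤ M :=
    fun v hv => hmax v (subset_convexHull ℝ _ hv)
  have hb : ∀ i, l (b i) ≤ M := fun i => hV _ (Or.inl ⟨i, rfl⟩)
  have hb' : ∀ i, -l (b i) ≤ M := fun i => by simpa using hV _ (Or.inr ⟨i, rfl⟩)
  have hF' : F = {x ∈ crossPolytope b | (l : E →ₗ[ℝ] ℝ) x = M} := by
    rw [hl]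
    ext x
    refine and_congr_right fun hx => ⟨fun h => le_antisymm (hmax x hx) (h x₀ hx₀P), fun h y hy => ?_⟩
    exact (hmax y hy).trans h.ge
  rw [hF', crossPolytope, setOf_mem_convexHull_eq _ hV]
  by_cases hM0 : M = 0
  · left
    congr 1
    ext v
    refine ⟨fun h => h.1, fun h => ⟨h, ?_⟩⟩
    have h0 : ∀ i, l (b i) = 0 := fun i => by linarith [hb i, hb' i]
    rcases h with ⟨j, rfl⟩ | ⟨j, rfl⟩ <;> simp [h0, hM0]
  · right
    refine ⟨Finset.univ.filter fun i => l (b i) = M ∨ -l (b i) = M,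
      Finset.univ.filter fun i => l (b i) = M, ?_, ?_⟩
    · intro i; simp +contextual
    · rw [crossFace]
      congr 1
      ext v
      constructor
      · rintro ⟨⟨j, rfl⟩ | ⟨j, rfl⟩, h⟩
        · have h' : l (b j) = M := h
          exact ⟨j, by simp [h'], by simp [signedVec, h']⟩
        · have h' : -l (b j) = M := by simpa using h
          have h2 : ¬ l (b j) = M := fun h3 => hM0 (by linarith)
          exact ⟨j, by simp [h'], by simp [signedVec, h2]⟩
      · rintro ⟨j, hj, rfl⟩
        have hj' : l (b j) = M ∨ -l (b j) = M := by simpa using hj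
        by_cases h : l (b j) = M
        · simp [signedVec, h]
        · have := hj'.resolve_left h
          simp only [signedVec, Finset.mem_filter, Finset.mem_univ, true_and, h, if_false]
          exact ⟨Or.inr ⟨j, rfl⟩, by simpa using this⟩

theorem faceNumber_crossPolytope [Fintype ι] [ContinuousAdd E]
    [ContinuousSMul ℝ E] [FiniteDimensional ℝ E] (hφ : ∀ i j, φ i (b j) = if i = j then 1 else 0) (k : ℕ) (hk : k ≤ Fintype.card ι) :
    faceNumber (crossPolytope b) ((k : ℤ) - 1) = 2 ^ k * (Fintype.card ι).choose k := by
  have hφ' : ∀ i j, (φ i : E →ₗ[ℝ] ℝ) (b j) = if i = j then 1 else 0 := hφ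
  let I : Finset (Σ _ : Finset ι, Finset ι) :=
    (Finset.powersetCard k Finset.univ).sigma fun T => T.powerset
  have hI : I.card = 2 ^ k * (Fintype.card ι).choose k := by
    rw [Finset.card_sigma, Finset.sum_congr rfl (g := fun _ => 2 ^ k)]
    · simp [mul_comm]
    · intro T hT
      rw [Finset.card_powerset, (Finset.mem_powersetCard.1 hT).2]
  have himg : {F : Set E | IsExposed ℝ (crossPolytope b) F ∧ faceDim F = (k : ℤ) - 1} =
      (fun p : Σ _ : Finset ι, Finset ι => crossFace b p.1 p.2) '' (I : Set _) := by
    ext F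
    constructor
    · rintro ⟨hF, hd⟩
      have : ∃ T U : Finset ι, U ⊆ T ∧ F = crossFace b T U := by
        rcases hF.eq_or_exists_crossFace with h | h
        · rcases isEmpty_or_nonempty ι with _ | _
          · exact ⟨∅, ∅, subset_rfl, by
              rw [h, crossFace, crossPolytope, Set.range_eq_empty, Set.range_eq_empty]; simp⟩
          · have := card_le_faceDim_crossPolytope hφ'
            rw [← h, hd] at this
            omega
        · exact h
      obtain ⟨T, U, hU, rfl⟩ := this
      rw [faceDim_crossFace hφ'] at hd
      refine ⟨⟨T, U⟩, ?_, rfl⟩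
      simp only [I, Finset.coe_sigma, Set.mem_sigma_iff, Finset.mem_coe, Finset.mem_powersetCard,
        Finset.mem_powerset, Finset.subset_univ, true_and]
      exact ⟨by omega, hU⟩
    · rintro ⟨⟨T, U⟩, h, rfl⟩
      simp only [I, Finset.coe_sigma, Set.mem_sigma_iff, Finset.mem_coe, Finset.mem_powersetCard,
        Finset.mem_powerset, Finset.subset_univ, true_and] at h
      exact ⟨isExposed_crossFace hφ T U, by simp only [faceDim_crossFace hφ', h.1]⟩
  rw [faceNumber, himg, Set.InjOn.ncard_image, Set.ncard_coe_finset, hI]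
  rintro ⟨T, U⟩ h ⟨T', U'⟩ h' heq
  simp only [I, Finset.coe_sigma, Set.mem_sigma_iff, Finset.mem_coe,
    Finset.mem_powerset] at h h'
  obtain ⟨rfl, rfl⟩ := crossFace_injOn hφ' h.2 h'.2 heq
  rfl

end Exposed

end CrossPolytope

/-! ### Splits and their equivalence relations -/

namespace Split

variable {X : Type u}

theorem mem_sides_iff (σ : Split X) (C : Set X) : C ∈ σ.sides ↔ ∃ x, C = {y | σ.Rel x y} := by
  obtain ⟨A, B, ⟨a, ha⟩, ⟨b, hb⟩, hd, hu, hs⟩ := σ.exists_sides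
  have hdis : ∀ i, i ∈ A → i ∉ B := fun i h1 h2 => Set.disjoint_left.mp hd h1 h2
  have hA : ∀ x ∈ A, {y | σ.Rel x y} = A := fun x hx => by
    ext y; simp [Rel, hs, hx, hdis x hx]
  have hB : ∀ x ∈ B, {y | σ.Rel x y} = B := fun x hx => by
    have : x ∉ A := fun h => hdis x h hx
    ext y; simp [Rel, hs, hx, this]
  constructor
  · rw [hs]
    rintro (rfl | rfl)
    · exact ⟨a, (hA a ha).symm⟩
    · exact ⟨b, (hB b hb).symm⟩
  · rintro ⟨x, rfl⟩
    rw [hs]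
    rcases (hu ▸ Set.mem_univ x : x ∈ A ∪ B) with h | h
    · exact Or.inl (hA x h)
    · exact Or.inr (hB x h)

theorem ext_rel {σ τ : Split X} (h : ∀ x y, σ.Rel x y ↔ τ.Rel x y) : σ = τ := by
  refine Split.ext (Set.ext fun C => ?_)
  simp only [mem_sides_iff, h]

theorem exists_not_rel (σ : Split X) : ∃ x y, ¬ σ.Rel x y := by
  obtain ⟨A, B, ⟨a, ha⟩, ⟨b, hb⟩, hd, -, hs⟩ := σ.exists_sides
  refine ⟨a, b, ?_⟩
  rintro ⟨C, hC, h1, h2⟩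
  rw [hs] at hC
  rcases hC with rfl | rfl
  · exact Set.disjoint_left.mp hd h2 hb
  · exact Set.disjoint_left.mp hd ha h1

theorem delta_of_rel {σ : Split X} {x y : X} (h : σ.Rel x y) : σ.delta x y = 0 := if_pos h

theorem delta_of_not_rel {σ : Split X} {x y : X} (h : ¬ σ.Rel x y) : σ.delta x y = 1 := if_neg h

theorem delta_nonneg (σ : Split X) (x y : X) : 0 ≤ σ.delta x y := by
  unfold delta; split_ifs <;> norm_num

theorem delta_triangle (σ : Split X) (x y z : X) : σ.delta x z ≤ σ.delta x y + σ.delta y z := by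
  have h := σ.rel_equivalence
  by_cases h1 : σ.Rel x y
  · by_cases h2 : σ.Rel y z
    · rw [delta_of_rel (h.trans h1 h2), delta_of_rel h1, delta_of_rel h2, add_zero]
    · have h3 : ¬ σ.Rel x z := fun h3 => h2 (h.trans (h.symm h1) h3)
      rw [delta_of_rel h1, delta_of_not_rel h2, delta_of_not_rel h3, zero_add]
  · have h4 : σ.delta x z ≤ 1 := by unfold delta; split_ifs <;> norm_num
    have := σ.delta_nonneg y z
    rw [delta_of_not_rel h1]
    linarith

theorem sideVec_compl (A : Set X) : sideVec Aᶜ = -sideVec A := by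
  simp [sideVec]

/-- On sum-zero vectors `𝟙_{Aᶜ}` acts as `-𝟙_A`, and the two coefficients of `sideVec A` add up to
`1`. -/
theorem dotProduct_sideVec [Fintype X] [Nonempty X] (A : Set X) {x : X → ℝ} (hx : ∑ i, x i = 0) :
    x ⬝ᵥ sideVec A = x ⬝ᵥ indVec A := by
  have h1 : x ⬝ᵥ indVec Aᶜ = -(x ⬝ᵥ indVec A) := by
    rw [eq_neg_iff_add_eq_zero, ← dotProduct_add, ← hx]
    unfold indVec
    rw [Set.indicator_compl_add_self]
    simp [dotProduct]
  have h2 : (A.ncard : ℝ) + Aᶜ.ncard = Nat.card X := by exact_mod_cast Set.ncard_add_ncard_compl A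
  have h3 : (Nat.card X : ℝ) ≠ 0 := by exact_mod_cast Nat.card_pos.ne'
  rw [sideVec, dotProduct_sub, dotProduct_smul, dotProduct_smul, h1, smul_eq_mul, smul_eq_mul]
  rw [← h2] at h3 ⊢
  field_simp
  ring

end Split

theorem splitPartition_iff_forall_rel {X : Type u} {S : Finset (Split X)} (i j : X) :
    splitPartition S i j ↔ ∀ σ ∈ S, σ.Rel i j :=
  splitDist_eq_zero_iff (fun _ _ => one_pos) i j

/-- Each `δ_σ` satisfies the triangle inequality and has positive weight, so equality of the sums
forces equality termwise. -/
theorem delta_eq_add_of_splitDist_eq_add {X : Type u} {S : Finset (Split X)} {α : Split X → ℝ}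
    (hα : ∀ σ ∈ S, 0 < α σ) {x y z : X}
    (h : splitDist S α x z = splitDist S α x y + splitDist S α y z) {σ : Split X} (hσ : σ ∈ S) :
    σ.delta x z = σ.delta x y + σ.delta y z := by
  unfold splitDist at h
  rw [← Finset.sum_add_distrib] at h
  have := (Finset.sum_eq_sum_iff_of_le fun τ hτ => by
    rw [← mul_add]
    exact mul_le_mul_of_nonneg_left (τ.delta_triangle x y z) (hα τ hτ).le).1 h σ hσ
  rw [← mul_add] at this
  exact mul_left_cancel₀ (hα σ hσ).ne' this

/-! ### Boolean intersection posets -/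

/-- If `i ∈ T \ T'`, the witness `x i` lies in the intersection over `T'` but not in the one over
`T`, so distinct index sets have distinct intersections. -/
theorem nonempty_intersectionPoset_orderIso {V : Type u} [AddCommGroup V] [Module ℝ V] {ι : Type v}
    (H : ι → Submodule ℝ V) (x : ι → V) (hx : ∀ i j, x i ∈ H j ↔ i ≠ j) :
    Nonempty (IntersectionPoset (Set.range H) ≃o Set ι) := by
  let f : Set ι → IntersectionPoset (Set.range H) := fun T =>
    OrderDual.toDual ⟨sInf (H '' T), H '' T, Set.image_subset_range _ _, rfl⟩
  have hf : ∀ T T', f T ≤ f T' ↔ T ≤ T' := by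
    intro T T'
    change sInf (H '' T') ≤ sInf (H '' T) ↔ T ⊆ T'
    refine ⟨fun h i hi => ?_, fun h => sInf_le_sInf (Set.image_mono h)⟩
    by_contra hi'
    have h1 : x i ∈ sInf (H '' T') := by
      rw [Submodule.mem_sInf]
      rintro _ ⟨j, hj, rfl⟩
      exact (hx i j).2 fun hij => hi' (hij ▸ hj)
    have h2 := (Submodule.mem_sInf.1 (h h1)) (H i) ⟨i, hi, rfl⟩
    exact (hx i i).1 h2 rfl
  have hsurj : Function.Surjective f := by
    rintro ⟨W, ℬ, hℬ, rfl⟩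
    refine ⟨H ⁻¹' ℬ, ?_⟩
    have : H '' (H ⁻¹' ℬ) = ℬ := Set.image_preimage_eq_of_subset hℬ
    exact congrArg OrderDual.toDual (Subtype.ext (congrArg sInf this))
  exact ⟨(RelIso.ofSurjective (OrderEmbedding.ofMapLEIff f hf) hsurj).symm⟩

/-! ### Edge cut systems -/

/-- The combinatorial content of a weighted tree on the vertex set `X`, with edges indexed by `E`:
deleting the edge `e` from `src e` to `tgt e` leaves two components, one of which is `side e`. -/
structure EdgeCutSystem {X : Type u} (d : X → X → ℝ) (E : Type v) [Fintype E] where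
  src : E → X
  tgt : E → X
  side : E → Set X
  weight : E → ℝ
  weight_pos : ∀ e, 0 < weight e
  src_mem : ∀ e, src e ∈ side e
  tgt_notMem : ∀ e, tgt e ∉ side e
  src_mem_iff : ∀ e f, e ≠ f → (src f ∈ side e ↔ tgt f ∈ side e)
  connected : ∀ Q : X → Prop, (∀ e, Q (src e) ↔ Q (tgt e)) → ∀ x y, Q x → Q y
  dist_eq : ∀ x y, d x y = ∑ e, weight e * |indVec (side e) x - indVec (side e) y|

namespace EdgeCutSystem

variable {X : Type u} {d : X → X → ℝ} {E : Type v} [Fintype E] (C : EdgeCutSystem d E)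

/-- The split of `X` obtained by deleting an edge. -/
def edgeSplit (e : E) : Split X where
  sides := {C.side e, (C.side e)ᶜ}
  exists_sides := ⟨C.side e, (C.side e)ᶜ, ⟨_, C.src_mem e⟩, ⟨_, C.tgt_notMem e⟩,
    disjoint_compl_right, Set.union_compl_self _, rfl⟩

theorem edgeSplit_rel (e : E) (x y : X) :
    (C.edgeSplit e).Rel x y ↔ (x ∈ C.side e ↔ y ∈ C.side e) := by
  simp only [Split.Rel, edgeSplit, Set.mem_insert_iff, Set.mem_singleton_iff, exists_eq_or_imp,
    exists_eq_left, Set.mem_compl_iff]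
  tauto

theorem edgeSplit_rel_src_tgt (e f : E) : (C.edgeSplit e).Rel (C.src f) (C.tgt f) ↔ e ≠ f := by
  rw [edgeSplit_rel]
  refine ⟨?_, C.src_mem_iff e f⟩
  rintro h rfl
  exact C.tgt_notMem e (h.1 (C.src_mem e))

theorem edgeSplit_injective : Function.Injective C.edgeSplit := by
  intro e f h
  by_contra hef
  have := (C.edgeSplit_rel_src_tgt e f).2 hef
  rw [h, edgeSplit_rel_src_tgt] at this
  exact this rfl

theorem edgeSplit_delta (e : E) (x y : X) :
    (C.edgeSplit e).delta x y = |indVec (C.side e) x - indVec (C.side e) y| := by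
  rw [Split.delta]
  by_cases hx : x ∈ C.side e <;> by_cases hy : y ∈ C.side e <;>
    simp [edgeSplit_rel, indVec, hx, hy]

theorem indVec_src_sub_tgt [DecidableEq E] (e f : E) :
    indVec (C.side e) (C.src f) - indVec (C.side e) (C.tgt f) = if e = f then 1 else 0 := by
  unfold indVec
  split_ifs with h
  · subst h
    simp [C.src_mem e, C.tgt_notMem e]
  · by_cases h' : C.src f ∈ C.side e
    · simp [h', (C.src_mem_iff e f h).1 h']
    · have h2 : C.tgt f ∉ C.side e := fun h2 => h' ((C.src_mem_iff e f h).2 h2)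
      simp [h', h2]

/-- The splits of all edges. -/
def splits : Finset (Split X) := Finset.univ.map ⟨C.edgeSplit, C.edgeSplit_injective⟩

theorem mem_splits {σ : Split X} : σ ∈ C.splits ↔ ∃ e, C.edgeSplit e = σ := by simp [splits]

theorem exists_side_of_ne {e f : E} (h : e ≠ f) :
    ∃ A ∈ (C.edgeSplit e).sides, C.src f ∉ A ∧ C.tgt f ∉ A ∧ (∀ g, g ≠ e →
      (C.src g ∈ A ↔ C.tgt g ∈ A)) := by
  have hf := C.src_mem_iff e f h
  have hg := fun g (hg : g ≠ e) => C.src_mem_iff e g hg.symm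
  by_cases h1 : C.src f ∈ C.side e
  · refine ⟨(C.side e)ᶜ, Or.inr rfl, by simpa using h1, by simpa using hf.1 h1, fun g hge => ?_⟩
    rw [Set.mem_compl_iff, Set.mem_compl_iff, hg g hge]
  · exact ⟨C.side e, Or.inl rfl, h1, fun h2 => h1 (hf.2 h2), hg⟩

/-- Take the side `A` of `e` away from the edge `f` and the side `B` of `f` away from `e`. No edge
enters or leaves `A ∩ B`, so by connectedness it is empty. -/
theorem edgeSplit_compatible (e f : E) : (C.edgeSplit e).Compatible (C.edgeSplit f) := by
  by_cases hef : e = f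
  · subst hef
    exact ⟨C.side e, Or.inl rfl, (C.side e)ᶜ, Or.inr rfl, Set.inter_compl_self _⟩
  obtain ⟨A, hA, hA1, hA2, hA3⟩ := C.exists_side_of_ne hef
  obtain ⟨B, hB, hB1, hB2, hB3⟩ := C.exists_side_of_ne (Ne.symm hef)
  refine ⟨A, hA, B, hB, Set.eq_empty_of_forall_notMem fun x hx => ?_⟩
  refine absurd (C.connected (· ∈ A ∩ B) (fun g => ?_) x (C.src f) hx) fun h => hA1 h.1
  by_cases hge : g = e
  · subst hge; simp [hB1, hB2]
  by_cases hgf : g = f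
  · subst hgf; simp [hA1, hA2]
  · simp only [Set.mem_inter_iff, hA3 g hge, hB3 g hgf]

theorem isCompatibleDecomposition : IsCompatibleDecomposition d C.splits := by
  constructor
  · intro σ hσ τ hτ
    obtain ⟨e, rfl⟩ := C.mem_splits.1 hσ
    obtain ⟨f, rfl⟩ := C.mem_splits.1 hτ
    exact C.edgeSplit_compatible e f
  · refine ⟨Function.extend C.edgeSplit C.weight 0, fun σ hσ => ?_, fun x y => ?_⟩
    · obtain ⟨e, rfl⟩ := C.mem_splits.1 hσ
      rw [C.edgeSplit_injective.extend_apply]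
      exact C.weight_pos e
    · rw [C.dist_eq, splitDist, splits, Finset.sum_map]
      refine Finset.sum_congr rfl fun e _ => ?_
      simp only [Function.Embedding.coeFn_mk, C.edgeSplit_injective.extend_apply, edgeSplit_delta]

/-! ### Distances across an edge and uniqueness of the decomposition -/

theorem dist_src_tgt (e : E) : d (C.src e) (C.tgt e) = C.weight e := by
  classical
  rw [C.dist_eq, Finset.sum_eq_single e]
  · simp [C.indVec_src_sub_tgt]
  · intro f _ h
    simp [C.indVec_src_sub_tgt, h]
  · simp

theorem dist_comm (C : EdgeCutSystem d E) (x y : X) : d x y = d y x := by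
  simp_rw [C.dist_eq, abs_sub_comm]

/-- The path from `x` to `tgt e` ends with `e`: only `e` separates its ends, and it does not
separate `x` from `src e`. -/
theorem dist_tgt_of_mem {e : E} {x : X} (hx : x ∈ C.side e) :
    d x (C.tgt e) = d x (C.src e) + d (C.src e) (C.tgt e) := by
  simp_rw [C.dist_eq, ← Finset.sum_add_distrib, ← mul_add, ← edgeSplit_delta]
  refine Finset.sum_congr rfl fun f _ => ?_
  congr 1
  have hr := (C.edgeSplit f).rel_equivalence
  by_cases h : f = e
  · subst h
    have h1 : (C.edgeSplit f).Rel x (C.src f) := by rw [edgeSplit_rel]; simp [hx, C.src_mem]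
    have h2 : ¬ (C.edgeSplit f).Rel x (C.tgt f) := by rw [edgeSplit_rel]; simp [hx, C.tgt_notMem]
    rw [Split.delta_of_rel h1, Split.delta_of_not_rel h2, Split.delta_of_not_rel, zero_add]
    rw [edgeSplit_rel_src_tgt]; simp
  · have h1 := (C.edgeSplit_rel_src_tgt f e).2 h
    rw [Split.delta_of_rel h1, add_zero]
    by_cases h2 : (C.edgeSplit f).Rel x (C.src e)
    · rw [Split.delta_of_rel h2, Split.delta_of_rel (hr.trans h2 h1)]
    · rw [Split.delta_of_not_rel h2,
        Split.delta_of_not_rel fun h3 => h2 (hr.trans h3 (hr.symm h1))]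

/-- The same edge cut system with all edges reversed. -/
def reverse : EdgeCutSystem d E where
  src := C.tgt
  tgt := C.src
  side e := (C.side e)ᶜ
  weight := C.weight
  weight_pos := C.weight_pos
  src_mem := C.tgt_notMem
  tgt_notMem e := not_not.2 (C.src_mem e)
  src_mem_iff e f h := not_congr (C.src_mem_iff e f h).symm
  connected Q hQ := C.connected Q fun e => (hQ e).symm
  dist_eq x y := by
    rw [C.dist_eq]
    refine Finset.sum_congr rfl fun e _ => ?_
    congr 1
    unfold indVec
    rw [Set.indicator_compl]
    simp only [Pi.sub_apply, Pi.one_apply]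
    rw [abs_sub_comm]
    congr 1
    ring

theorem dist_src_of_notMem {e : E} {x : X} (hx : x ∉ C.side e) :
    d x (C.src e) = d x (C.tgt e) + d (C.tgt e) (C.src e) :=
  C.reverse.dist_tgt_of_mem hx

theorem eq_splits {S : Finset (Split X)} (hS : IsCompatibleDecomposition d S) : S = C.splits := by
  obtain ⟨-, α, hα, hd⟩ := hS
  have key : ∀ σ ∈ S, ∀ e, ¬ σ.Rel (C.src e) (C.tgt e) → σ = C.edgeSplit e := by
    intro σ hσ e he
    have hr := σ.rel_equivalence
    -- `δ_σ` is at most `1`, so along a geodesic `σ` can separate only once.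
    have hadd : ∀ x y z, d x z = d x y + d y z → ¬ σ.Rel y z → σ.Rel x y := by
      intro x y z h hyz
      by_contra hxy
      rw [hd, hd x y, hd y z] at h
      have h1 := delta_eq_add_of_splitDist_eq_add hα h hσ
      have h2 : σ.delta x z ≤ 1 := by unfold Split.delta; split_ifs <;> norm_num
      rw [Split.delta_of_not_rel hxy, Split.delta_of_not_rel hyz] at h1
      linarith
    have h1 : ∀ x ∈ C.side e, σ.Rel x (C.src e) := fun x hx =>
      hadd _ _ _ (C.dist_tgt_of_mem hx) he
    have h2 : ∀ x ∉ C.side e, σ.Rel x (C.tgt e) := fun x hx =>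
      hadd _ _ _ (C.dist_src_of_notMem hx) fun h => he (hr.symm h)
    refine Split.ext_rel fun x y => ?_
    rw [edgeSplit_rel]
    by_cases hx : x ∈ C.side e <;> by_cases hy : y ∈ C.side e
    · simpa [hx, hy] using hr.trans (h1 x hx) (hr.symm (h1 y hy))
    · simpa [hx, hy] using fun h => he (hr.trans (hr.symm (h1 x hx)) (hr.trans h (h2 y hy)))
    · simpa [hx, hy] using fun h =>
        he (hr.trans (hr.symm (h1 y hy)) (hr.trans (hr.symm h) (h2 x hx)))
    · simpa [hx, hy] using hr.trans (h2 x hx) (hr.symm (h2 y hy))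
  ext σ
  rw [mem_splits]
  constructor
  · intro hσ
    have hr := σ.rel_equivalence
    obtain ⟨x, y, hxy⟩ := σ.exists_not_rel
    obtain ⟨e, he⟩ : ∃ e, ¬ σ.Rel (C.src e) (C.tgt e) := by
      by_contra! h
      exact hxy (C.connected (σ.Rel x) (fun e => ⟨fun h' => hr.trans h' (h e),
        fun h' => hr.trans h' (hr.symm (h e))⟩) x y (hr.refl x))
    exact ⟨e, (key σ hσ e he).symm⟩
  · rintro ⟨e, rfl⟩
    obtain ⟨σ, hσ, he⟩ : ∃ σ ∈ S, ¬ σ.Rel (C.src e) (C.tgt e) := by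
      by_contra! h
      have h0 := (splitDist_eq_zero_iff hα _ _).2 h
      rw [← hd, C.dist_src_tgt] at h0
      exact (C.weight_pos e).ne' h0
    rwa [← key σ hσ e he]

theorem splitPartition_src_tgt {S : Finset (Split X)} (hS : S ⊆ C.splits) (e : E) :
    splitPartition S (C.src e) (C.tgt e) ↔ C.edgeSplit e ∉ S := by
  rw [splitPartition_iff_forall_rel]
  constructor
  · intro h he
    exact (C.edgeSplit_rel_src_tgt e e).1 (h _ he) rfl
  · intro he σ hσ
    obtain ⟨f, rfl⟩ := C.mem_splits.1 (hS hσ)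
    rw [edgeSplit_rel_src_tgt]
    rintro rfl
    exact he hσ

theorem splitPartition_injOn : Set.InjOn splitPartition {S | S ⊆ C.splits} := by
  intro S hS T hT h
  have key : ∀ e, C.edgeSplit e ∈ S ↔ C.edgeSplit e ∈ T := fun e => by
    rw [← not_iff_not, ← C.splitPartition_src_tgt hS, ← C.splitPartition_src_tgt hT, h]
  ext σ
  constructor
  · intro hσ
    obtain ⟨e, rfl⟩ := C.mem_splits.1 (hS hσ)
    exact (key e).1 hσ
  · intro hσ
    obtain ⟨e, rfl⟩ := C.mem_splits.1 (hT hσ)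
    exact (key e).2 hσ

/-- The root vector of an edge. -/
noncomputable def edgeVec (e : E) : X → ℝ := indVec {C.src e} - indVec {C.tgt e}

theorem indVec_sub_indVec (x y : X) :
    indVec {x} - indVec {y} =
      ∑ e, (indVec (C.side e) x - indVec (C.side e) y) • C.edgeVec e := by
  classical
  have hF : ∀ f, indVec {C.src f} - indVec {C.tgt f} =
      ∑ e, (indVec (C.side e) (C.src f) - indVec (C.side e) (C.tgt f)) • C.edgeVec e := by
    intro f
    simp [C.indVec_src_sub_tgt, edgeVec]
  -- By duality the expansion holds for the ends of an edge. So `F` agrees at both ends of every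
  -- edge and is constant by connectedness.
  let F : X → X → ℝ := fun z => indVec {z} - ∑ e, indVec (C.side e) z • C.edgeVec e
  have hF' : ∀ f, F (C.src f) = F (C.tgt f) := by
    intro f
    have := hF f
    simp only [sub_smul, Finset.sum_sub_distrib] at this
    simp only [F]
    rw [sub_eq_sub_iff_sub_eq_sub, this]
  have h := C.connected (fun z => F x = F z) (fun f => by rw [hF' f]) x y rfl
  simp only [sub_smul, Finset.sum_sub_distrib]
  rwa [← sub_eq_sub_iff_sub_eq_sub]

theorem eq_of_forall_mem_side_iff {x y : X} (h : ∀ e, x ∈ C.side e ↔ y ∈ C.side e) : x = y := by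
  have h0 := C.indVec_sub_indVec x y
  rw [Finset.sum_eq_zero] at h0
  · by_contra hxy
    have := congrFun h0 x
    simp [indVec, hxy] at this
  · intro e _
    by_cases hx : x ∈ C.side e
    · simp [indVec, hx, (h e).1 hx]
    · have hy : y ∉ C.side e := fun h' => hx ((h e).2 h')
      simp [indVec, hx, hy]

theorem dist_pos (C : EdgeCutSystem d E) {x y : X} (h : x ≠ y) : 0 < d x y := by
  have hnn : ∀ e ∈ Finset.univ, 0 ≤ C.weight e * (C.edgeSplit e).delta x y := fun e _ =>
    mul_nonneg (C.weight_pos e).le (Split.delta_nonneg _ _ _)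
  simp_rw [C.dist_eq, ← edgeSplit_delta]
  refine (Finset.sum_nonneg hnn).lt_of_ne' fun h0 => h (C.eq_of_forall_mem_side_iff fun e => ?_)
  rw [Finset.sum_eq_zero_iff_of_nonneg hnn] at h0
  have h1 := (mul_eq_zero.1 (h0 e (Finset.mem_univ e))).resolve_left (C.weight_pos e).ne'
  rw [← edgeSplit_rel]
  by_contra h2
  rw [Split.delta_of_not_rel h2] at h1
  exact one_ne_zero h1

/-- The vertex `e_{i,j}` of the fundamental polytope, for `i`, `j` the ends of an edge. -/
noncomputable def edgeElemVec (e : E) : X → ℝ := elemVec d (C.src e) (C.tgt e)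

theorem elemVec_eq_sum (x y : X) : elemVec d x y =
    ∑ e, ((d x y)⁻¹ * (C.weight e * (indVec (C.side e) x - indVec (C.side e) y))) •
      C.edgeElemVec e := by
  rw [elemVec, C.indVec_sub_indVec, Finset.smul_sum]
  refine Finset.sum_congr rfl fun e _ => ?_
  rw [edgeElemVec, elemVec, C.dist_src_tgt, ← edgeVec, smul_smul, smul_smul]
  congr 1
  have := (C.weight_pos e).ne'
  field_simp

/-- The coefficients of `e_{i,j}` have absolute values summing to `d(i,j) / d(i,j) = 1`; conversely
each signed edge vector is one of the generators. -/
theorem fundamentalPolytope_eq : fundamentalPolytope d = crossPolytope C.edgeElemVec := by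
  refine Set.Subset.antisymm (convexHull_min ?_ (convex_convexHull ℝ _)) (convexHull_mono ?_)
  · rintro _ ⟨i, j, hij, rfl⟩
    rw [C.elemVec_eq_sum]
    refine sum_smul_mem_crossPolytope _ _ ?_
    have hd := C.dist_pos hij
    simp_rw [abs_mul, ← Finset.mul_sum, abs_of_pos (C.weight_pos _)]
    rw [← C.dist_eq, abs_of_pos (inv_pos.2 hd), inv_mul_cancel₀ hd.ne']
  · have hne : ∀ e, C.src e ≠ C.tgt e := fun e h => C.tgt_notMem e (h ▸ C.src_mem e)
    rintro _ (⟨e, rfl⟩ | ⟨e, rfl⟩)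
    · exact ⟨_, _, hne e, rfl⟩
    · refine ⟨_, _, (hne e).symm, ?_⟩
      rw [Pi.neg_apply, edgeElemVec, elemVec, elemVec, C.dist_comm, ← smul_neg, neg_sub]

/-! ### The arrangement and the dual functionals -/

section Fintype

variable [Fintype X]

theorem dotProduct_indVec_singleton (a : X → ℝ) (x : X) : a ⬝ᵥ indVec {x} = a x := by
  classical
  rw [indVec, dotProduct, Finset.sum_eq_single x]
  · simp
  · intro y _ h
    simp [h]
  · simp

theorem dotProduct_edgeVec [DecidableEq E] (e f : E) :
    indVec (C.side e) ⬝ᵥ C.edgeVec f = if e = f then 1 else 0 := by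
  rw [edgeVec, dotProduct_sub, dotProduct_indVec_singleton, dotProduct_indVec_singleton,
    C.indVec_src_sub_tgt]

theorem edgeVec_mem_ambientSpace (e : E) : C.edgeVec e ∈ ambientSpace C.splits := by
  constructor
  · have h := fun x : X => dotProduct_indVec_singleton (1 : X → ℝ) x
    have : ∑ i, C.edgeVec e i = (1 : X → ℝ) ⬝ᵥ C.edgeVec e := by simp [dotProduct]
    rw [this, edgeVec, dotProduct_sub, h, h, Pi.one_apply, Pi.one_apply, sub_self]
  · intro i j h
    rw [splitPartition_iff_forall_rel] at h
    -- The splits of all edges separate points, so the blocks are singletons.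
    rw [C.eq_of_forall_mem_side_iff (x := i) (y := j)]
    intro f
    exact (C.edgeSplit_rel f i j).1 (h _ (C.mem_splits.2 ⟨f, rfl⟩))

theorem mem_splitHyperplane_iff {S : Finset (Split X)} (e : E) (x : ambientSpace S) :
    x ∈ splitHyperplane S (C.edgeSplit e) ↔ indVec (C.side e) ⬝ᵥ (x : X → ℝ) = 0 := by
  have : Nonempty X := ⟨C.src e⟩
  rw [dotProduct_comm, ← Split.dotProduct_sideVec _ x.2.1]
  constructor
  · intro h
    exact h _ (subset_convexHull ℝ _ ⟨C.side e, Or.inl rfl, rfl⟩)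
  · intro h y hy
    refine convexHull_min (t := {y | (x : X → ℝ) ⬝ᵥ y = 0}) ?_ ?_ hy
    · rintro _ ⟨A, rfl | rfl, rfl⟩
      · exact h
      · simp [Split.sideVec_compl, h]
    · intro a ha b hb s t _ _ _
      simp only [Set.mem_ofPred_eq] at ha hb ⊢
      simp [ha, hb]

theorem nonempty_intersectionPoset_splitArrangement :
    Nonempty (IntersectionPoset (splitArrangement C.splits) ≃o Set E) := by
  classical
  have h : splitArrangement C.splits =
      Set.range fun e => splitHyperplane C.splits (C.edgeSplit e) := by
    ext W
    simp only [splitArrangement, Set.mem_image, Finset.mem_coe, mem_splits, Set.mem_range]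
    constructor
    · rintro ⟨_, ⟨e, rfl⟩, h⟩
      exact ⟨e, h⟩
    · rintro ⟨e, h⟩
      exact ⟨_, ⟨e, rfl⟩, h⟩
  rw [h]
  refine nonempty_intersectionPoset_orderIso _
    (fun e => ⟨C.edgeVec e, C.edgeVec_mem_ambientSpace e⟩) fun i j => ?_
  rw [mem_splitHyperplane_iff, dotProduct_edgeVec]
  simp [eq_comm]

/-- The functional dual to `edgeElemVec e`. -/
noncomputable def edgeFunctional (e : E) : (X → ℝ) →L[ℝ] ℝ :=
  LinearMap.toContinuousLinearMap (C.weight e • dotProductBilin ℝ ℝ (indVec (C.side e)))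

theorem edgeFunctional_edgeElemVec [DecidableEq E] (e f : E) :
    C.edgeFunctional e (C.edgeElemVec f) = if e = f then 1 else 0 := by
  have : C.edgeFunctional e (C.edgeElemVec f) =
      C.weight e * (indVec (C.side e) ⬝ᵥ ((C.weight f)⁻¹ • C.edgeVec f)) := by
    rw [← C.dist_src_tgt f]; rfl
  rw [this, dotProduct_smul, dotProduct_edgeVec]
  split_ifs with h
  · subst h
    simp [(C.weight_pos e).ne']
  · simp

end Fintype

end EdgeCutSystem

/-! ### Edge cut systems of weighted trees -/

section Tree

variable {V : Type u} {G : SimpleGraph V}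

theorem not_reachable_deleteEdges_of_isTree (hG : G.IsTree) {a b : V} (h : G.Adj a b) :
    ¬ (G.deleteEdges {s(a, b)}).Reachable a b :=
  SimpleGraph.isAcyclic_iff_forall_adj_isBridge.1 hG.isAcyclic h

theorem reachable_deleteEdges_of_adj {a b : V} {e : Sym2 V} (h : G.Adj a b) (he : e ≠ s(a, b)) :
    (G.deleteEdges {e}).Reachable a b :=
  SimpleGraph.Adj.reachable (by simpa [h] using he.symm)

/-- Induction on the trail: if it starts with `e`, the rest avoids `e` and the bridge `e` separates
the ends; otherwise its first edge survives the deletion. -/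
theorem mem_edges_iff_not_reachable (hG : G.IsTree) (e : Sym2 V) {a b : V} (p : G.Walk a b)
    (hp : p.IsTrail) : e ∈ p.edges ↔ ¬ (G.deleteEdges {e}).Reachable a b := by
  induction p with
  | nil => simp
  | @cons a c b h p ih =>
    rw [SimpleGraph.Walk.isTrail_cons] at hp
    have ih := ih hp.1
    rw [SimpleGraph.Walk.edges_cons, List.mem_cons]
    by_cases he : e = s(a, c)
    · subst he
      have hcb : (G.deleteEdges {s(a, c)}).Reachable c b := by
        by_contra hcb
        exact hp.2 (ih.2 hcb)
      simp only [true_or, true_iff]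
      exact fun hab => not_reachable_deleteEdges_of_isTree hG h (hab.trans hcb.symm)
    · have hac := reachable_deleteEdges_of_adj h he
      simp only [he, false_or, ih]
      exact not_congr ⟨hac.trans, hac.symm.trans⟩

theorem weightedDist_eq_sum [Fintype G.edgeSet] (hG : G.IsTree) (w : Sym2 V → ℝ) (a b : V)
    (r : Sym2 V → Prop) [DecidablePred r]
    (hr : ∀ e, r e ↔ ¬ (G.deleteEdges {e}).Reachable a b) :
    weightedDist G w a b = ∑ e : G.edgeSet, w e * if r e then 1 else 0 := by
  classical
  obtain ⟨p, hp, huniq⟩ := hG.existsUnique_path a b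
  let P : G.Path a b := ⟨p, hp⟩
  have : Unique (G.Path a b) := ⟨⟨P⟩, fun q => Subtype.ext (huniq q q.2)⟩
  rw [weightedDist, ciInf_unique]
  have hP : ((default : G.Path a b) : G.Walk a b) = p := huniq _ (default : G.Path a b).2
  rw [hP, ← List.sum_toFinset _ hp.isTrail.edges_nodup]
  have hsub : p.edges.toFinset = G.edgeFinset.filter r := by
    ext e
    rw [List.mem_toFinset, Finset.mem_filter, SimpleGraph.mem_edgeFinset, hr,
      ← mem_edges_iff_not_reachable hG e p hp.isTrail, iff_and_self]
    exact fun h => p.edges_subset_edgeSet h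
  rw [hsub, Finset.sum_filter, SimpleGraph.edgeFinset]
  simp_rw [mul_ite, mul_one, mul_zero]
  exact Finset.sum_set_coe G.edgeSet (f := fun e => if r e then w e else 0) |>.symm

theorem connected_induction (hG : G.Connected) (Q : V → Prop)
    (hQ : ∀ a b, G.Adj a b → (Q a ↔ Q b)) (a b : V) (h : Q a) : Q b := by
  obtain ⟨p⟩ := hG.preconnected a b
  induction p with
  | nil => exact h
  | cons hadj p ih => exact ih ((hQ _ _ hadj).1 h)

end Tree

theorem IsFullTree.exists_edgeCutSystem {X : Type u} [Fintype X] {d : X → X → ℝ}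
    (hd : IsFullTree d) :
    ∃ (E : Type u) (_ : Fintype E), Fintype.card E + 1 = Fintype.card X ∧
      Nonempty (EdgeCutSystem d E) := by
  classical
  obtain ⟨V, _, T, w, hw, hdist, hbij⟩ := hd
  have := Fintype.ofFinite V
  let φ : X ≃ V := Equiv.ofBijective T.label hbij
  have hφ : ∀ x, T.label x = φ x := fun _ => rfl
  let G := T.graph
  have hG : G.IsTree := T.isTree
  -- The orientation of each edge is an arbitrary choice.
  let s : G.edgeSet → V := fun e => (e : Sym2 V).out.1
  let t : G.edgeSet → V := fun e => (e : Sym2 V).out.2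
  have hst : ∀ e : G.edgeSet, (e : Sym2 V) = s(s e, t e) := fun e => (Quot.out_eq (e : Sym2 V)).symm
  have hadj : ∀ e, G.Adj (s e) (t e) := fun e => by
    have := e.2
    rwa [hst e, SimpleGraph.mem_edgeSet] at this
  let side : G.edgeSet → Set V := fun e => {a | (G.deleteEdges {(e : Sym2 V)}).Reachable (s e) a}
  have htgt : ∀ e, t e ∉ side e := fun e h => by
    refine not_reachable_deleteEdges_of_isTree hG (hadj e) ?_
    rw [← hst e]
    exact h
  have hmem : ∀ e f, e ≠ f → (s f ∈ side e ↔ t f ∈ side e) := fun e f hef => by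
    have : (G.deleteEdges {(e : Sym2 V)}).Reachable (s f) (t f) :=
      reachable_deleteEdges_of_adj (hadj f) (hst f ▸ Subtype.coe_ne_coe.2 hef)
    exact ⟨fun h => SimpleGraph.Reachable.trans h this,
      fun h => SimpleGraph.Reachable.trans h this.symm⟩
  -- Deleting `e` leaves no third component: the vertices reachable from either end are closed under
  -- adjacency in the tree.
  have hcov : ∀ e a, a ∉ side e → (G.deleteEdges {(e : Sym2 V)}).Reachable (t e) a := by
    intro e a ha
    have := connected_induction hG.connected
      (fun x => (G.deleteEdges {(e : Sym2 V)}).Reachable (s e) x ∨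
        (G.deleteEdges {(e : Sym2 V)}).Reachable (t e) x) ?_ (s e) a (Or.inl (.refl _))
    · exact this.resolve_left ha
    · intro x y hxy
      by_cases h : (e : Sym2 V) = s(x, y)
      · have h' : s(s e, t e) = s(x, y) := (hst e).symm.trans h
        rcases Sym2.eq_iff.1 h' with ⟨h1, h2⟩ | ⟨h1, h2⟩
        · rw [← h1, ← h2]
          exact iff_of_true (Or.inl (.refl _)) (Or.inr (.refl _))
        · rw [← h1, ← h2]
          exact iff_of_true (Or.inr (.refl _)) (Or.inl (.refl _))
      · have h2 := reachable_deleteEdges_of_adj hxy h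
        exact or_congr ⟨fun h => h.trans h2, fun h => h.trans h2.symm⟩
          ⟨fun h => h.trans h2, fun h => h.trans h2.symm⟩
  have hreach : ∀ (e : G.edgeSet) a b, (G.deleteEdges {(e : Sym2 V)}).Reachable a b ↔
      (a ∈ side e ↔ b ∈ side e) := by
    intro e a b
    refine ⟨fun h => ⟨fun h' => SimpleGraph.Reachable.trans h' h,
      fun h' => SimpleGraph.Reachable.trans h' h.symm⟩, fun h => ?_⟩
    by_cases ha : a ∈ side e
    · exact SimpleGraph.Reachable.trans (SimpleGraph.Reachable.symm ha) (h.1 ha)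
    · exact (hcov e a ha).symm.trans (hcov e b fun hb => ha (h.2 hb))
  refine ⟨G.edgeSet, inferInstance, ?_, ⟨?_⟩⟩
  · rw [Fintype.card_congr φ, ← hG.card_edgeFinset, SimpleGraph.edgeFinset_card]
  exact
    { src := fun e => φ.symm (s e)
      tgt := fun e => φ.symm (t e)
      side := fun e => φ ⁻¹' side e
      weight := fun e => w e
      weight_pos := fun e => hw e e.2
      src_mem := fun e => by
        rw [Set.mem_preimage, φ.apply_symm_apply]
        exact SimpleGraph.Reachable.refl _
      tgt_notMem := fun e => by
        rw [Set.mem_preimage, φ.apply_symm_apply]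
        exact htgt e
      src_mem_iff := fun e f hef => by
        simp only [Set.mem_preimage, φ.apply_symm_apply]
        exact hmem e f hef
      connected := fun Q hQ x y hx => by
        have := connected_induction hG.connected (fun a => Q (φ.symm a)) ?_ (φ x) (φ y) (by simpa)
        · simpa using this
        · intro a b hab
          let e : G.edgeSet := ⟨Sym2.mk a b, hab⟩
          have h := hQ e
          have h' : Sym2.mk a b = s(s e, t e) := hst e
          rcases Sym2.eq_iff.1 h' with ⟨h1, h2⟩ | ⟨h1, h2⟩
          · rw [h1, h2]
            exact h
          · rw [h1, h2]
            exact h.symm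
      dist_eq := fun x y => by
        rw [hdist, weightedDist_eq_sum hG w _ _ _ fun _ => Iff.rfl]
        refine Finset.sum_congr rfl fun e _ => ?_
        congr 1
        simp only [hreach, hφ, indVec]
        by_cases hx : φ x ∈ side e <;> by_cases hy : φ y ∈ side e <;> simp [hx, hy] }

theorem mainTheorem7 {X : Type*} [Fintype X] (d : X → X → ℝ) (hd : IsFullTree d) :
    (∃! S : Finset (Split X), IsCompatibleDecomposition d S) ∧
    (∀ S : Finset (Split X), IsCompatibleDecomposition d S →
      Set.InjOn splitPartition {S' : Finset (Split X) | S' ⊆ S} ∧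
      Nonempty (IntersectionPoset (splitArrangement S) ≃o Set (Fin (Fintype.card X - 1)))) ∧
    (∀ i : ℕ, i ≤ Fintype.card X - 1 →
      faceNumber (fundamentalPolytope d) ((i : ℤ) - 1) =
        2 ^ i * (Fintype.card X - 1).choose i) := by
  classical
  obtain ⟨E, _, hcard, ⟨C⟩⟩ := hd.exists_edgeCutSystem
  -- The truncated subtraction is harmless, since `X` has one more element than `E`.
  rw [← hcard, Nat.add_sub_cancel]
  refine ⟨⟨C.splits, C.isCompatibleDecomposition, fun S hS => C.eq_splits hS⟩, fun S hS => ?_,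
    fun i hi => ?_⟩
  · obtain rfl := C.eq_splits hS
    obtain ⟨f⟩ := C.nonempty_intersectionPoset_splitArrangement
    let g : Set E ≃o Set (Fin (Fintype.card E)) :=
      ⟨Equiv.Set.congr (Fintype.equivFin E), fun {s t} =>
        Set.image_subset_image_iff (Fintype.equivFin E).injective⟩
    exact ⟨C.splitPartition_injOn, ⟨f.trans g⟩⟩
  · rw [C.fundamentalPolytope_eq]
    exact faceNumber_crossPolytope C.edgeFunctional_edgeElemVec i hi
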